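/- For $s\in\mathbb N$, let $(D(z))_{z\in\mathbb C^s}$ be a strongly continuous family of unitary operators acting irreducibly on a complex Hilbert space $\mathcal H$ and satisfying $D(z)D(w)=e^{-i\,\mathrm{Im}(z^*w)}D(z+w)$. Equivalently, $D(z)=\exp\sum_j(z_ja_j^\dagger-\bar z_ja_j)$, where $a_1,\dots,a_s$ are the annihilation operators of $s$ bosonic modes. Let $|0\rangle$ be the vacuum, i.e. a unit vector with $a_j|0\rangle=0$ for all $j$, and let $|z\rangle=D(z)|0\rangle$ be the coherent states. Let $\mathcal H_A,\mathcal H_B$ be two such spaces, with $s_A$ and $s_B$ modes and displacement operators $D_A,D_B$, and let $K$ be a complex $s_B\times s_A$ matrix. Let $\Phi$ be a quantum-limited Gaussian gauge-contravariant channel with matrix $K$. That is, $\Phi$ is a completely positive trace-preserving linear map from the trace-class operators on $\mathcal H_A$ to those on $\mathcal H_B$, whose adjoint $\Phi^*$, defined by $\mathrm{Tr}\,\Phi[T]X=\mathrm{Tr}\,T\,\Phi^*[X]$, satisfies $$\Phi^*[D_B(z)]=D_A(K^t\bar z)\,\exp\!\big(-\tfrac12 z^*(I+KK^*)z\big),\qquad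 z\in\mathbb C^{s_B}.$$ Then for every state (density operator) $\rho$ on $\mathcal H_A$, the function $z\mapsto\pi^{-s_A}\langle z|\rho|z\rangle$ (the density of the outcome of the heterodyne measurement) is a probability density on $\mathbb C^{s_A}$ with respect to Lebesgue measure $d^{2s_A}z$, and $$\Phi[\rho]=\int_{\mathbb C^{s_A}}\frac{d^{2s_A}z}{\pi^{s_A}}\;|{-K\bar z}\rangle\langle{-K\bar z}|\;\langle z|\rho|z\rangle ,$$ where the integral converges as a Bochner integral in operator norm. Thus $\Phi$ is the measure-reprepare map which performs the heterodyne measurement and then prepares the coherent state $|{-K\bar z}\rangle$ when the outcome is $z$. -/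

import Mathlib

namespace Bosonic

noncomputable section

/-! ### Trace-class operators, states and channels -/

section TraceClass

variable {H : Type*} [NormedAddCommGroup H] [InnerProductSpace ℂ H] [CompleteSpace H]

/-- The trace `∑ᵢ ⟨eᵢ, T eᵢ⟩`, computed in a fixed orthonormal basis of `H`. For the trace-class
operators defined below it does not depend on the basis. -/
def trace (T : H →L[ℂ] H) : ℂ :=
  ∑' i, inner ℂ ((exists_hilbertBasis ℂ H).choose_spec.choose i)
    (T ((exists_hilbertBasis ℂ H).choose_spec.choose i))

/-- A positive operator with `∑ᵢ ⟨eᵢ, T eᵢ⟩ < ∞`. -/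
def IsPositiveFiniteTrace (T : H →L[ℂ] H) : Prop :=
  T.IsPositive ∧
    Summable fun i => inner ℂ ((exists_hilbertBasis ℂ H).choose_spec.choose i)
      (T ((exists_hilbertBasis ℂ H).choose_spec.choose i))

variable (H) in
/-- The space of trace-class operators: the linear span of the positive operators of finite
trace. -/
def traceClass : Submodule ℂ (H →L[ℂ] H) :=
  Submodule.span ℂ {T | IsPositiveFiniteTrace T}

/-- States (density operators): positive trace-class operators of trace one. -/
def IsState (ρ : traceClass H) : Prop :=
  (ρ : H →L[ℂ] H).IsPositive ∧ trace (ρ : H →L[ℂ] H) = 1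

end TraceClass

section Channel

variable {HA HB : Type*} [NormedAddCommGroup HA] [InnerProductSpace ℂ HA] [CompleteSpace HA]
  [NormedAddCommGroup HB] [InnerProductSpace ℂ HB] [CompleteSpace HB]

open scoped ComplexOrder in
/-- Complete positivity: for every `n`, a positive `n × n` operator matrix is sent to a positive
operator matrix. -/
def IsCompletelyPositive (Φ : traceClass HA →ₗ[ℂ] traceClass HB) : Prop :=
  ∀ (n : ℕ) (T : Fin n → Fin n → traceClass HA),
    (∀ x : Fin n → HA, 0 ≤ ∑ i, ∑ j, inner ℂ (x i) ((T i j : HA →L[ℂ] HA) (x j))) →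
    ∀ y : Fin n → HB, 0 ≤ ∑ i, ∑ j, inner ℂ (y i) ((Φ (T i j) : HB →L[ℂ] HB) (y j))

/-- A quantum channel in the Schrödinger picture: a completely positive trace-preserving linear
map between the spaces of trace-class operators. -/
structure IsChannel (Φ : traceClass HA →ₗ[ℂ] traceClass HB) : Prop where
  completelyPositive : IsCompletelyPositive Φ
  trace_map : ∀ T, trace (Φ T : HB →L[ℂ] HB) = trace (T : HA →L[ℂ] HA)

/-- `Φ^*[X] = Y`, where `Φ^*` is the Heisenberg-picture adjoint of `Φ`, i.e. the map on bounded
operators given by `Tr (Φ[T] X) = Tr (T Φ^*[X])` for all trace-class `T`. -/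
def AdjointMapsTo (Φ : traceClass HA →ₗ[ℂ] traceClass HB)
    (X : HB →L[ℂ] HB) (Y : HA →L[ℂ] HA) : Prop :=
  ∀ T : traceClass HA,
    trace ((Φ T : HB →L[ℂ] HB) * X) = trace ((T : HA →L[ℂ] HA) * Y)

end Channel

/-! ### Weyl systems, the vacuum and coherent states -/

section Weyl

variable {s : ℕ} {H : Type*} [NormedAddCommGroup H] [InnerProductSpace ℂ H] [CompleteSpace H]

/-- Displacement operators of `s` bosonic modes: a strongly continuous family of unitaries
`D(z)`, `z ∈ ℂ^s`, acting irreducibly on `H` and satisfying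
`D(z) D(w) = exp(-i Im (z^* w)) D(z + w)`. -/
structure IsWeylSystem (D : (Fin s → ℂ) → (H →L[ℂ] H)) : Prop where
  mem_unitary : ∀ z, D z ∈ unitary (H →L[ℂ] H)
  mul_eq : ∀ z w, D z * D w =
    Complex.exp (-(Complex.I * ((star z ⬝ᵥ w).im : ℂ))) • D (z + w)
  continuous : ∀ x, Continuous fun z => D z x
  nontrivial : Nontrivial H
  irreducible : ∀ V : Submodule ℂ H, IsClosed (V : Set H) →
    (∀ z, ∀ x ∈ V, D z x ∈ V) → V = ⊥ ∨ V = ⊤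

/-- `ψ` is in the domain of the annihilation operator `a_j`, and `a_j ψ = φ`. As
`D(z) = exp (∑ⱼ z_j a_j^† - conj z_j a_j)`, the generators of `t ↦ D(t e_j)` and `t ↦ D(i t e_j)`
are `A = a_j^† - a_j` and `B = i (a_j^† + a_j)`, so that `a_j = -(A + i B) / 2`. -/
def AnnihilationMapsTo (D : (Fin s → ℂ) → (H →L[ℂ] H)) (j : Fin s) (ψ φ : H) : Prop :=
  ∃ v w : H,
    HasDerivAt (fun t : ℝ => D (Pi.single j (t : ℂ)) ψ) v 0 ∧
    HasDerivAt (fun t : ℝ => D (Pi.single j (Complex.I * (t : ℂ))) ψ) w 0 ∧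
    φ = -(1 / 2 : ℂ) • (v + Complex.I • w)

/-- `Ω` is a vacuum vector `|0⟩`: a unit vector with `a_j Ω = 0` for all `j`. -/
def IsVacuum (D : (Fin s → ℂ) → (H →L[ℂ] H)) (Ω : H) : Prop :=
  ‖Ω‖ = 1 ∧ ∀ j, AnnihilationMapsTo D j Ω 0

/-- The coherent state vector `|z⟩ = D(z)|0⟩`. -/
def coherent (D : (Fin s → ℂ) → (H →L[ℂ] H)) (Ω : H) (z : Fin s → ℂ) : H :=
  D z Ω

/-- The probability density `π^{-s} ⟨z|ρ|z⟩` of the outcome `z` of the heterodyne measurement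
in the state `ρ`, with respect to Lebesgue measure on `ℂ^s`. -/
def heterodyneDensity (D : (Fin s → ℂ) → (H →L[ℂ] H)) (Ω : H) (ρ : H →L[ℂ] H)
    (z : Fin s → ℂ) : ℝ :=
  (Real.pi ^ s)⁻¹ * (inner ℂ (coherent D Ω z) (ρ (coherent D Ω z))).re

/-- The projection `|z⟩⟨z|` on a coherent state. -/
def coherentProj (D : (Fin s → ℂ) → (H →L[ℂ] H)) (Ω : H) (z : Fin s → ℂ) : H →L[ℂ] H :=
  InnerProductSpace.rankOne ℂ (coherent D Ω z) (coherent D Ω z)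

end Weyl

/-! ### Gaussian gauge-contravariant channels -/

section Contravariant

variable {sA sB : ℕ}
  {HA HB : Type*} [NormedAddCommGroup HA] [InnerProductSpace ℂ HA] [CompleteSpace HA]
  [NormedAddCommGroup HB] [InnerProductSpace ℂ HB] [CompleteSpace HB]

open scoped ComplexOrder in
/-- A Gaussian gauge-contravariant channel with parameters `K`, `μ`: a channel with
`Φ^*[D_B(z)] = exp(-z^* μ z) D_A(K^t conj z)`, where `μ` is Hermitian and
`μ ≥ (I + K K^*) / 2`. -/
structure IsGaussianContravariant
    (DA : (Fin sA → ℂ) → (HA →L[ℂ] HA)) (DB : (Fin sB → ℂ) → (HB →L[ℂ] HB))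
    (K : Matrix (Fin sB) (Fin sA) ℂ) (μ : Matrix (Fin sB) (Fin sB) ℂ)
    (Φ : traceClass HA →ₗ[ℂ] traceClass HB) : Prop where
  isChannel : IsChannel Φ
  isHermitian : μ.IsHermitian
  le : (μ - (1 / 2 : ℂ) • (1 + K * K.conjTranspose)).PosSemidef
  adjoint_displacement : ∀ z : Fin sB → ℂ,
    AdjointMapsTo Φ (DB z)
      (Complex.exp (-(star z ⬝ᵥ μ.mulVec z)) • DA (K.transpose.mulVec (star z)))

/-- A quantum-limited Gaussian gauge-contravariant channel with matrix `K`: the noise `μ` is the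
minimal one, `μ = (I + K K^*) / 2`. -/
def IsQuantumLimitedContravariant
    (DA : (Fin sA → ℂ) → (HA →L[ℂ] HA)) (DB : (Fin sB → ℂ) → (HB →L[ℂ] HB))
    (K : Matrix (Fin sB) (Fin sA) ℂ) (Φ : traceClass HA →ₗ[ℂ] traceClass HB) : Prop :=
  IsGaussianContravariant DA DB K ((1 / 2 : ℂ) • (1 + K * K.conjTranspose)) Φ

end Contravariant

end

end Bosonic

namespace Bosonic

noncomputable section

open MeasureTheory Filter Topology
open scoped ComplexConjugate InnerProductSpace Matrix

/-! ### Weyl relations. -/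

section WeylAlgebra

variable {s : ℕ} {H : Type*} [NormedAddCommGroup H] [InnerProductSpace ℂ H] [CompleteSpace H]
  {D : (Fin s → ℂ) → (H →L[ℂ] H)} {Ω : H}

/-! Both sides of the identity have the same characteristic function `w ↦ Tr (T D_B(w))`, and a
positive operator of finite trace is determined by it.

Put `v = K^t conj w`. The adjoint relation gives `Tr (Φ[ρ] D_B(w)) = exp(-|w|²/2) exp(-|v|²/2) Tr (ρ
D_A(v))`. The factor `exp(-|v|²/2) Tr (ρ D_A(v))` is the Fourier transform of the heterodyne density
(`IsVacuum.integral_heterodyneDensity_mul_cexp`). The factor `exp(-|w|²/2)`, multiplied by the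
Fourier phase at `u`, is the expectation of `D_B(w)` in the coherent state `|-K conj u⟩`
(`IsVacuum.inner_coherent_neg_mulVec`). Hence `IsQuantumLimitedContravariant.trace_map_mul`: the
characteristic function of `Φ[ρ]` is the heterodyne average of those of the reprepared states.

Inversion is `IsVacuum.integral_overlap_mul_trace`. It rests on orthogonality relations for matrix
elements of `D`, which are Gaussian integrals on coherent vectors and extend to other vectors
because irreducibility makes the coherent span dense. The Gaussians come from `⟨0|D(z)|0⟩ =
exp(-|z|²/2)`, obtained by integrating the equations `a_j|0⟩ = 0`. -/

lemma conj_star_dotProduct (z w : Fin s → ℂ) : conj (star z ⬝ᵥ w) = star w ⬝ᵥ z := by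
  simp [dotProduct, mul_comm]

lemma I_mul_im_star_dotProduct (z w : Fin s → ℂ) :
    Complex.I * ((star z ⬝ᵥ w).im : ℂ) = (star z ⬝ᵥ w - star w ⬝ᵥ z) / 2 := by
  rw [← conj_star_dotProduct z w, Complex.sub_conj]
  push_cast
  ring

lemma IsWeylSystem.apply_apply (hD : IsWeylSystem D) (z w : Fin s → ℂ) (x : H) :
    D z (D w x) = Complex.exp ((star w ⬝ᵥ z - star z ⬝ᵥ w) / 2) • D (z + w) x := by
  have h := congrArg (fun T : H →L[ℂ] H => T x) (hD.mul_eq z w)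
  simp only [mul_apply_eq_comp, smul_apply,
    I_mul_im_star_dotProduct] at h
  rw [h]
  congr 2
  ring

lemma IsWeylSystem.add_apply (hD : IsWeylSystem D) (z w : Fin s → ℂ) (x : H) :
    D (z + w) x = Complex.exp ((star z ⬝ᵥ w - star w ⬝ᵥ z) / 2) • D z (D w x) := by
  rw [hD.apply_apply, smul_smul, ← Complex.exp_add]
  ring_nf
  simp

lemma IsWeylSystem.norm_apply (hD : IsWeylSystem D) (z : Fin s → ℂ) (x : H) :
    ‖D z x‖ = ‖x‖ :=
  ContinuousLinearMap.norm_map_of_mem_unitary (hD.mem_unitary z) x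

lemma IsWeylSystem.zero_apply (hD : IsWeylSystem D) (x : H) : D 0 x = x := by
  have h := hD.apply_apply 0 0 x
  simp only [dotProduct_zero, sub_self, zero_div, Complex.exp_zero, add_zero, one_smul] at h
  rw [← sub_eq_zero, ← norm_eq_zero, ← hD.norm_apply 0, map_sub, h, sub_self, norm_zero]

lemma IsWeylSystem.apply_neg_apply (hD : IsWeylSystem D) (z : Fin s → ℂ) (x : H) :
    D z (D (-z) x) = x := by
  rw [hD.apply_apply]
  simp [hD.zero_apply]

lemma IsWeylSystem.inner_apply_apply (hD : IsWeylSystem D) (z : Fin s → ℂ) (x y : H) :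
    ⟪D z x, D z y⟫_ℂ = ⟪x, y⟫_ℂ :=
  ContinuousLinearMap.inner_map_map_of_mem_unitary (hD.mem_unitary z) x y

lemma IsWeylSystem.inner_apply_right (hD : IsWeylSystem D) (z : Fin s → ℂ) (x y : H) :
    ⟪x, D z y⟫_ℂ = ⟪D (-z) x, y⟫_ℂ := by
  rw [← hD.inner_apply_apply z (D (-z) x), hD.apply_neg_apply]

lemma IsWeylSystem.inner_apply_left (hD : IsWeylSystem D) (z : Fin s → ℂ) (x y : H) :
    ⟪D z x, y⟫_ℂ = ⟪x, D (-z) y⟫_ℂ := by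
  rw [hD.inner_apply_right, neg_neg]

lemma IsWeylSystem.continuous_inner (hD : IsWeylSystem D) (x y : H) :
    Continuous fun z => ⟪x, D z y⟫_ℂ :=
  continuous_const.inner (hD.continuous y)

end WeylAlgebra

/-! ### Vacuum characteristic function and density of the coherent vectors. -/

section VacuumExpectation

variable {s : ℕ} {H : Type*} [NormedAddCommGroup H] [InnerProductSpace ℂ H] [CompleteSpace H]
  {D : (Fin s → ℂ) → (H →L[ℂ] H)} {Ω : H}

lemma hasDerivAt_cexp_real_mul (c : ℂ) :
    HasDerivAt (fun t : ℝ => Complex.exp ((t : ℂ) * c)) c 0 := by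
  have h : HasDerivAt (fun t : ℂ => Complex.exp (t * c)) (Complex.exp (0 * c) * (1 * c)) 0 :=
    ((hasDerivAt_id (0 : ℂ)).mul_const c).cexp
  have h' := HasDerivAt.comp_ofReal (z := 0) (by simpa using h)
  simpa using h'

/-- The derivative of a matrix element of `D` along `e`, by splitting `e` off to the right. -/
lemma IsWeylSystem.hasDerivAt_inner_right (hD : IsWeylSystem D) {e : Fin s → ℂ} {x v : H}
    (hv : HasDerivAt (fun t : ℝ => D ((t : ℂ) • e) x) v 0) (y : H) (z : Fin s → ℂ) :
    HasDerivAt (fun t : ℝ => ⟪y, D (z + (t : ℂ) • e) x⟫_ℂ)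
      ((star z ⬝ᵥ e - star e ⬝ᵥ z) / 2 * ⟪y, D z x⟫_ℂ + ⟪D (-z) y, v⟫_ℂ) 0 := by
  have h1 := hasDerivAt_cexp_real_mul ((star z ⬝ᵥ e - star e ⬝ᵥ z) / 2)
  have h2 : HasDerivAt (fun t : ℝ => ⟪D (-z) y, D ((t : ℂ) • e) x⟫_ℂ) ⟪D (-z) y, v⟫_ℂ 0 := by
    simpa using (hasDerivAt_const (0 : ℝ) (D (-z) y)).inner ℂ hv
  refine ((h1.mul h2).congr_deriv ?_).congr_of_eventuallyEq (.of_forall fun t => ?_)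
  · simp [hD.zero_apply, hD.inner_apply_right z]
  · simp only [Pi.mul_apply]
    rw [hD.add_apply, inner_smul_right, hD.inner_apply_right z]
    congr 2
    simp
    ring

/-- The derivative of a matrix element of `D` along `e`, by splitting `e` off to the left. -/
lemma IsWeylSystem.hasDerivAt_inner_left (hD : IsWeylSystem D) {e : Fin s → ℂ} {y v : H}
    (hv : HasDerivAt (fun t : ℝ => D ((t : ℂ) • e) y) v 0) (x : H) (z : Fin s → ℂ) :
    HasDerivAt (fun t : ℝ => ⟪y, D (z + (t : ℂ) • e) x⟫_ℂ)
      ((star e ⬝ᵥ z - star z ⬝ᵥ e) / 2 * ⟪y, D z x⟫_ℂ - ⟪v, D z x⟫_ℂ) 0 := by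
  have h1 := hasDerivAt_cexp_real_mul ((star e ⬝ᵥ z - star z ⬝ᵥ e) / 2)
  have hv' : HasDerivAt (fun t : ℝ => D ((-t : ℂ) • e) y) (-v) 0 := by
    have h := HasDerivAt.scomp (0 : ℝ) (by simpa using hv) (hasDerivAt_neg (0 : ℝ))
    simpa [Function.comp_def] using h
  have h2 : HasDerivAt (fun t : ℝ => ⟪D ((-t : ℂ) • e) y, D z x⟫_ℂ) (-⟪v, D z x⟫_ℂ) 0 := by
    simpa using hv'.inner ℂ (hasDerivAt_const (0 : ℝ) (D z x))
  refine ((h1.mul h2).congr_deriv ?_).congr_of_eventuallyEq (.of_forall fun t => ?_)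
  · simp [hD.zero_apply]
    ring
  · simp only [Pi.mul_apply]
    rw [add_comm, hD.add_apply, inner_smul_right, hD.inner_apply_right ((t : ℂ) • e), neg_smul]
    congr 2
    simp
    ring

/-- This is the differential equation of a Gaussian. The directions `1` and `i` are the two in which
the vacuum condition provides derivatives, and they span each coordinate over the reals. -/
lemma IsVacuum.hasDerivAt_inner (hD : IsWeylSystem D) (hΩ : IsVacuum D Ω) (j : Fin s) {c : ℂ}
    (hc : c = 1 ∨ c = Complex.I) (z : Fin s → ℂ) :
    HasDerivAt (fun t : ℝ => ⟪Ω, D (z + (t : ℂ) • Pi.single j c) Ω⟫_ℂ)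
      (-((star z ⬝ᵥ Pi.single j c + star (Pi.single j c) ⬝ᵥ z) / 2) * ⟪Ω, D z Ω⟫_ℂ) 0 := by
  obtain ⟨v, w, hv, hw, h0⟩ := hΩ.2 j
  have hw' : w = Complex.I • v := by
    have h : v + Complex.I • w = 0 := by
      have := smul_eq_zero.mp h0.symm
      simpa using this
    rw [eq_neg_of_add_eq_zero_left h, smul_neg, smul_smul, Complex.I_mul_I]
    simp
  have hv1 : HasDerivAt (fun t : ℝ => D ((t : ℂ) • Pi.single j 1) Ω) v 0 := by
    convert hv using 4
    rw [← Pi.single_smul]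
    simp
  have hw1 : HasDerivAt (fun t : ℝ => D ((t : ℂ) • Pi.single j Complex.I) Ω) w 0 := by
    convert hw using 4
    rw [← Pi.single_smul]
    simp [mul_comm]
  -- Splitting off to the right and to the left computes the same derivative. With `w = i v`, the
  -- inner product is linear in one slot and antilinear in the other, so `e1 - i e2` eliminates `⟪v,
  -- D z Ω⟫`.
  have e1 := (hD.hasDerivAt_inner_right hv1 Ω z).unique (hD.hasDerivAt_inner_left hv1 Ω z)
  have e2 := (hD.hasDerivAt_inner_right hw1 Ω z).unique (hD.hasDerivAt_inner_left hw1 Ω z)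
  have s1 (c : ℂ) : star z ⬝ᵥ Pi.single j c = conj (z j) * c := by simp
  have s2 (c : ℂ) : star (Pi.single j c) ⬝ᵥ z = conj c * z j := by
    rw [← conj_star_dotProduct, s1]; simp [mul_comm]
  simp only [s1, s2, hw', inner_smul_left, inner_smul_right, Complex.conj_I, map_one, one_mul,
    mul_one] at e1 e2
  have hI := Complex.I_mul_I
  have key : ⟪D (-z) Ω, v⟫_ℂ = -conj (z j) * ⟪Ω, D z Ω⟫_ℂ := by
    linear_combination (e1 - Complex.I * e2) / 2 + (hI) * (conj (z j) * ⟪Ω, D z Ω⟫_ℂ +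
      z j * ⟪Ω, D z Ω⟫_ℂ + ⟪D (-z) Ω, v⟫_ℂ - ⟪v, D z Ω⟫_ℂ) / 2
  rcases hc with rfl | rfl
  · convert hD.hasDerivAt_inner_right hv1 Ω z using 1
    simp only [s1, s2, key, map_one]
    ring
  · convert hD.hasDerivAt_inner_right hw1 Ω z using 1
    simp only [s1, s2, hw', inner_smul_right, key, Complex.conj_I]
    ring

/-- By the differential equation, multiplying the matrix element by `exp(|z|²/2)` makes its
derivative vanish along the line, at every base point. -/
lemma IsVacuum.inner_add_single (hD : IsWeylSystem D) (hΩ : IsVacuum D Ω) (j : Fin s) {c : ℂ}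
    (hc : c = 1 ∨ c = Complex.I) (z : Fin s → ℂ) (t : ℝ) :
    Complex.exp ((star (z + (t : ℂ) • Pi.single j c) ⬝ᵥ (z + (t : ℂ) • Pi.single j c)) / 2) *
      ⟪Ω, D (z + (t : ℂ) • Pi.single j c) Ω⟫_ℂ =
    Complex.exp ((star z ⬝ᵥ z) / 2) * ⟪Ω, D z Ω⟫_ℂ := by
  set e : Fin s → ℂ := Pi.single j c with he
  let g : ℝ → ℂ := fun t => Complex.exp ((star (z + (t : ℂ) • e) ⬝ᵥ (z + (t : ℂ) • e)) / 2) *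
    ⟪Ω, D (z + (t : ℂ) • e) Ω⟫_ℂ
  have hg0 (u : Fin s → ℂ) : HasDerivAt (fun t : ℝ =>
      Complex.exp ((star (u + (t : ℂ) • e) ⬝ᵥ (u + (t : ℂ) • e)) / 2) *
        ⟪Ω, D (u + (t : ℂ) • e) Ω⟫_ℂ) 0 0 := by
    have h1 : HasDerivAt (fun t : ℝ =>
        Complex.exp ((star (u + (t : ℂ) • e) ⬝ᵥ (u + (t : ℂ) • e)) / 2))
        (Complex.exp ((star u ⬝ᵥ u) / 2) * ((star u ⬝ᵥ e + star e ⬝ᵥ u) / 2)) 0 := by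
      have h3 : HasDerivAt (fun t : ℂ => (star u ⬝ᵥ u) / 2 +
          (t * ((star u ⬝ᵥ e + star e ⬝ᵥ u) / 2) + t ^ 2 * ((star e ⬝ᵥ e) / 2)))
          ((star u ⬝ᵥ e + star e ⬝ᵥ u) / 2) 0 := by
        have := (((hasDerivAt_id (0 : ℂ)).mul_const ((star u ⬝ᵥ e + star e ⬝ᵥ u) / 2)).add
          (((hasDerivAt_id (0 : ℂ)).pow 2).mul_const ((star e ⬝ᵥ e) / 2))).const_add
          ((star u ⬝ᵥ u) / 2)
        simpa using this
      have h4 := HasDerivAt.comp_ofReal (z := 0) (by simpa using h3.cexp)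
      convert h4 using 1
      funext t
      congr 1
      simp only [star_add, star_smul, add_dotProduct, dotProduct_add, smul_dotProduct,
        dotProduct_smul, smul_eq_mul]
      simp
      ring
    have h2 := h1.mul (IsVacuum.hasDerivAt_inner hD hΩ j hc u)
    refine h2.congr_deriv ?_
    simp only [← he, Complex.ofReal_zero, zero_smul, add_zero]
    ring
  have hg (t₀ : ℝ) : HasDerivAt g 0 t₀ := by
    have h := hg0 (z + (t₀ : ℂ) • e)
    have h' : HasDerivAt (fun t : ℝ => g (t₀ + t)) 0 0 := by
      convert h using 1
      funext t
      simp only [g]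
      rw [add_assoc, ← add_smul]
      push_cast
      rfl
    simpa using HasDerivAt.comp_const_add (-t₀) t₀ (f := fun t : ℝ => g (t₀ + t))
      (by simpa using h')
  have := is_const_of_deriv_eq_zero (fun x => (hg x).differentiableAt) (fun x => (hg x).deriv) t 0
  simpa [g] using this

/-- The vacuum characteristic function `⟨0|D(z)|0⟩ = exp(-|z|²/2)`. -/
lemma IsVacuum.inner_apply (hD : IsWeylSystem D) (hΩ : IsVacuum D Ω) (z : Fin s → ℂ) :
    ⟪Ω, D z Ω⟫_ℂ = Complex.exp (-(star z ⬝ᵥ z) / 2) := by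
  let g : (Fin s → ℂ) → ℂ := fun z => Complex.exp ((star z ⬝ᵥ z) / 2) * ⟪Ω, D z Ω⟫_ℂ
  have hstep (z : Fin s → ℂ) (j : Fin s) (c : ℂ) : g (z + Pi.single j c) = g z := by
    have hsplit : z + Pi.single j c =
        (z + (c.re : ℂ) • Pi.single j 1) + (c.im : ℂ) • Pi.single j Complex.I := by
      rw [← Pi.single_smul, ← Pi.single_smul, add_assoc, ← Pi.single_add]
      simp
    rw [hsplit]
    exact (IsVacuum.inner_add_single hD hΩ j (Or.inr rfl) _ _).trans
      (IsVacuum.inner_add_single hD hΩ j (Or.inl rfl) _ _)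
  have hsum (S : Finset (Fin s)) : g (∑ j ∈ S, Pi.single j (z j)) = g 0 := by
    induction S using Finset.induction_on with
    | empty => simp
    | insert j S hj ih => rw [Finset.sum_insert hj, add_comm, hstep, ih]
  have h := hsum Finset.univ
  rw [Finset.univ_sum_single] at h
  have h0 : g 0 = 1 := by
    simp [g, hD.zero_apply, inner_self_eq_norm_sq_to_K, hΩ.1]
  rw [h0] at h
  rw [neg_div, Complex.exp_neg]
  exact eq_inv_of_mul_eq_one_right h

/-- Matrix elements of displacement operators between coherent vectors. -/
lemma IsVacuum.inner_coherent (hD : IsWeylSystem D) (hΩ : IsVacuum D Ω) (a b w : Fin s → ℂ) :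
    ⟪coherent D Ω a, D w (coherent D Ω b)⟫_ℂ =
      Complex.exp (-(star a ⬝ᵥ a) / 2 - (star b ⬝ᵥ b) / 2 - (star w ⬝ᵥ w) / 2 +
        star a ⬝ᵥ b + star a ⬝ᵥ w - star w ⬝ᵥ b) := by
  rw [coherent, coherent, hD.inner_apply_left, hD.apply_apply w b, map_smul, hD.apply_apply,
    inner_smul_right, inner_smul_right, hΩ.inner_apply hD, ← Complex.exp_add, ← Complex.exp_add]
  congr 1
  simp only [star_add, star_neg, add_dotProduct, dotProduct_add, neg_dotProduct, dotProduct_neg]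
  ring

lemma IsVacuum.norm_coherent (hD : IsWeylSystem D) (hΩ : IsVacuum D Ω) (z : Fin s → ℂ) :
    ‖coherent D Ω z‖ = 1 := by
  rw [coherent, hD.norm_apply, hΩ.1]

/-- Displacements permute coherent vectors up to phases, so the closed span is invariant; it
contains the vacuum, so irreducibility leaves only the whole space. -/
lemma IsVacuum.dense_span_coherent (hD : IsWeylSystem D) (hΩ : IsVacuum D Ω) :
    Dense (Submodule.span ℂ (Set.range (coherent D Ω)) : Set H) := by
  set V := Submodule.span ℂ (Set.range (coherent D Ω))
  rw [Submodule.dense_iff_topologicalClosure_eq_top]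
  refine (hD.irreducible _ V.isClosed_topologicalClosure ?_).resolve_left ?_
  · intro z x hx
    have hmap : ∀ y ∈ V, D z y ∈ V := by
      intro y hy
      induction hy using Submodule.span_induction with
      | mem y hy =>
        obtain ⟨w, rfl⟩ := hy
        rw [coherent, hD.apply_apply]
        exact V.smul_mem _ (Submodule.subset_span ⟨_, rfl⟩)
      | zero => simp
      | add a b _ _ ha hb => rw [map_add]; exact V.add_mem ha hb
      | smul c a _ ha => rw [map_smul]; exact V.smul_mem c ha
    exact map_mem_closure (D z).continuous hx hmap
  · intro h
    have h1 : Ω ∈ V.topologicalClosure :=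
      V.le_topologicalClosure (Submodule.subset_span ⟨0, hD.zero_apply Ω⟩)
    rw [h, Submodule.mem_bot] at h1
    simpa [h1] using hΩ.1

end VacuumExpectation

/-! ### Gaussian integrals over `ℂ^s`. -/

section GaussianIntegrals

lemma cexp_gaussian_eq_mul (r : ℝ) (p q w : ℂ) :
    Complex.exp (-(r * (conj w * w)) + p * w + conj w * q) =
      Complex.exp (-(r : ℂ) * (w.re : ℂ) ^ 2 + (p + q) * w.re + 0) *
        Complex.exp (-(r : ℂ) * (w.im : ℂ) ^ 2 + Complex.I * (p - q) * w.im + 0) := by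
  rw [← Complex.exp_add]
  congr 1
  have h : conj w * w = (w.re : ℂ) ^ 2 + (w.im : ℂ) ^ 2 := by
    rw [← Complex.normSq_eq_conj_mul_self, Complex.normSq_apply]
    push_cast
    ring
  have h2 : conj w = w.re - w.im * Complex.I := Complex.ext (by simp) (by simp)
  rw [h, h2]
  nth_rw 3 [← Complex.re_add_im w]
  ring

/-- The rate is left free because a single overlap decays with `r = 1/2` and a product of two with
`r = 1`. -/
lemma integrable_cexp_gaussian_complex {r : ℝ} (hr : 0 < r) (p q : ℂ) :
    Integrable fun w : ℂ => Complex.exp (-(r * (conj w * w)) + p * w + conj w * q) := by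
  simp only [cexp_gaussian_eq_mul]
  have hr' : 0 < (r : ℂ).re := by simpa using hr
  exact Complex.volume_preserving_equiv_real_prod.integrable_comp_of_integrable
    ((integrable_cexp_quadratic hr' (p + q) 0).mul_prod
      (integrable_cexp_quadratic hr' (Complex.I * (p - q)) 0))

lemma integral_cexp_gaussian_complex (p q : ℂ) :
    ∫ w : ℂ, Complex.exp (-(conj w * w) + p * w + conj w * q) =
      Real.pi * Complex.exp (p * q) := by
  have h1 := cexp_gaussian_eq_mul 1 p q
  simp only [Complex.ofReal_one, one_mul] at h1
  simp only [h1]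
  have h := Complex.volume_preserving_equiv_real_prod.integral_comp
    Complex.measurableEquivRealProd.measurableEmbedding
    (fun x : ℝ × ℝ => Complex.exp (-1 * (x.1 : ℂ) ^ 2 + (p + q) * x.1 + 0) *
        Complex.exp (-1 * (x.2 : ℂ) ^ 2 + Complex.I * (p - q) * x.2 + 0))
  refine h.trans ?_
  rw [Measure.volume_eq_prod, integral_prod_mul
    (fun x : ℝ => Complex.exp (-1 * (x : ℂ) ^ 2 + (p + q) * x + 0))
    (fun x : ℝ => Complex.exp (-1 * (x : ℂ) ^ 2 + Complex.I * (p - q) * x + 0)),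
    integral_cexp_quadratic (by simp), integral_cexp_quadratic (by simp)]
  have hpi : ((Real.pi : ℂ) / - -1) ^ (1 / 2 : ℂ) * ((Real.pi : ℂ) / - -1) ^ (1 / 2 : ℂ) =
      Real.pi := by
    rw [← Complex.cpow_add _ _ (by simp [Real.pi_ne_zero])]
    norm_num
  rw [mul_mul_mul_comm, hpi, ← Complex.exp_add]
  congr 2
  rw [mul_pow, Complex.I_sq]
  ring

variable {s : ℕ}

lemma cexp_gaussian_eq_prod (r : ℝ) (p q w : Fin s → ℂ) :
    Complex.exp (-(r * (star w ⬝ᵥ w)) + p ⬝ᵥ w + star w ⬝ᵥ q) =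
      ∏ j, Complex.exp (-(r * (conj (w j) * w j)) + p j * w j + conj (w j) * q j) := by
  rw [← Complex.exp_sum]
  congr 1
  simp [dotProduct, Finset.sum_add_distrib, Finset.mul_sum]

lemma integrable_cexp_gaussian {r : ℝ} (hr : 0 < r) (p q : Fin s → ℂ) :
    Integrable fun w : Fin s → ℂ =>
      Complex.exp (-(r * (star w ⬝ᵥ w)) + p ⬝ᵥ w + star w ⬝ᵥ q) := by
  simp only [cexp_gaussian_eq_prod]
  exact Integrable.fintype_prod
    (f := fun j (w : ℂ) => Complex.exp (-(r * (conj w * w)) + p j * w + conj w * q j))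
    fun j => integrable_cexp_gaussian_complex hr (p j) (q j)

lemma integral_cexp_gaussian (p q : Fin s → ℂ) :
    ∫ w : Fin s → ℂ, Complex.exp (-(star w ⬝ᵥ w) + p ⬝ᵥ w + star w ⬝ᵥ q) =
      Real.pi ^ s * Complex.exp (p ⬝ᵥ q) := by
  have h := cexp_gaussian_eq_prod 1 p q
  simp only [Complex.ofReal_one, one_mul] at h
  simp only [h]
  rw [integral_fintype_prod_volume_eq_prod
    (fun j (w : ℂ) => Complex.exp (-(conj w * w) + p j * w + conj w * q j))]
  simp only [integral_cexp_gaussian_complex, Finset.prod_mul_distrib, Finset.prod_const,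
    Finset.card_univ, Fintype.card_fin, ← Complex.exp_sum]
  rfl

end GaussianIntegrals

/-! ### Orthogonality relations for matrix elements of displacements. -/

section Moyal

variable {s : ℕ} {H : Type*} [NormedAddCommGroup H] [InnerProductSpace ℂ H] [CompleteSpace H]
  {D : (Fin s → ℂ) → (H →L[ℂ] H)} {Ω : H}

lemma IsVacuum.ext_inner (hD : IsWeylSystem D) (hΩ : IsVacuum D Ω) {x y : H}
    (h : ∀ a, ⟪coherent D Ω a, x⟫_ℂ = ⟪coherent D Ω a, y⟫_ℂ) : x = y := by
  refine (hΩ.dense_span_coherent hD).eq_of_inner_right ℂ fun v hv => ?_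
  induction hv using Submodule.span_induction with
  | mem v hv => obtain ⟨a, rfl⟩ := hv; exact h a
  | zero => simp
  | add a b _ _ ha hb => rw [inner_add_left, inner_add_left, ha, hb]
  | smul c a _ ha => rw [inner_smul_left, inner_smul_left, ha]

lemma IsVacuum.ext_inner_clm (hD : IsWeylSystem D) (hΩ : IsVacuum D Ω) {S T : H →L[ℂ] H}
    (h : ∀ a b, ⟪coherent D Ω a, S (coherent D Ω b)⟫_ℂ =
      ⟪coherent D Ω a, T (coherent D Ω b)⟫_ℂ) : S = T := by
  refine ContinuousLinearMap.ext_on (hΩ.dense_span_coherent hD) ?_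
  rintro _ ⟨b, rfl⟩
  exact hΩ.ext_inner hD fun a => h a b

lemma IsVacuum.inner_coherent' (hD : IsWeylSystem D) (hΩ : IsVacuum D Ω) (a b w : Fin s → ℂ) :
    ⟪D w (coherent D Ω a), coherent D Ω b⟫_ℂ =
      Complex.exp (-(star a ⬝ᵥ a) / 2 - (star b ⬝ᵥ b) / 2 - (star w ⬝ᵥ w) / 2 +
        star a ⬝ᵥ b + star w ⬝ᵥ b - star a ⬝ᵥ w) := by
  rw [← inner_conj_symm, hΩ.inner_coherent hD, ← Complex.exp_conj]
  simp only [map_add, map_sub, map_neg, map_div₀, conj_star_dotProduct, map_ofNat]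
  congr 1
  ring

lemma IsVacuum.integrable_overlap (hD : IsWeylSystem D) (hΩ : IsVacuum D Ω)
    (a b : Fin s → ℂ) :
    Integrable fun w => ⟪D w (coherent D Ω a), coherent D Ω b⟫_ℂ := by
  convert (integrable_cexp_gaussian (r := 1 / 2) (by norm_num) (-star a) b).const_mul
    (Complex.exp (-(star a ⬝ᵥ a) / 2 - (star b ⬝ᵥ b) / 2 + star a ⬝ᵥ b)) using 2 with w
  rw [hΩ.inner_coherent' hD, ← Complex.exp_add, neg_dotProduct]
  congr 1
  push_cast
  ring

lemma IsVacuum.overlap_mul_overlap (hD : IsWeylSystem D) (hΩ : IsVacuum D Ω)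
    (a b c d w : Fin s → ℂ) :
    ⟪D w (coherent D Ω a), coherent D Ω b⟫_ℂ * ⟪coherent D Ω c, D w (coherent D Ω d)⟫_ℂ =
      Complex.exp (-(star a ⬝ᵥ a) / 2 - (star b ⬝ᵥ b) / 2 - (star c ⬝ᵥ c) / 2 -
        (star d ⬝ᵥ d) / 2 + star a ⬝ᵥ b + star c ⬝ᵥ d) *
      Complex.exp (-(star w ⬝ᵥ w) + (star c - star a) ⬝ᵥ w + star w ⬝ᵥ (b - d)) := by
  rw [hΩ.inner_coherent' hD, hΩ.inner_coherent hD, ← Complex.exp_add, ← Complex.exp_add]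
  congr 1
  simp only [sub_dotProduct, dotProduct_sub]
  ring

lemma IsVacuum.integrable_overlap_mul_overlap (hD : IsWeylSystem D) (hΩ : IsVacuum D Ω)
    (a b c d : Fin s → ℂ) :
    Integrable fun w => ⟪D w (coherent D Ω a), coherent D Ω b⟫_ℂ *
      ⟪coherent D Ω c, D w (coherent D Ω d)⟫_ℂ := by
  simp only [hΩ.overlap_mul_overlap hD]
  have := integrable_cexp_gaussian (r := 1) one_pos (star c - star a) (b - d)
  simp only [Complex.ofReal_one, one_mul] at this
  exact this.const_mul _

/-- Orthogonality relations for matrix elements between coherent vectors. -/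
lemma IsVacuum.integral_overlap_mul_overlap (hD : IsWeylSystem D) (hΩ : IsVacuum D Ω)
    (a b c d : Fin s → ℂ) :
    ∫ w, ⟪D w (coherent D Ω a), coherent D Ω b⟫_ℂ *
      ⟪coherent D Ω c, D w (coherent D Ω d)⟫_ℂ =
    Real.pi ^ s * (⟪coherent D Ω c, coherent D Ω b⟫_ℂ *
      ⟪coherent D Ω a, coherent D Ω d⟫_ℂ) := by
  simp only [hΩ.overlap_mul_overlap hD]
  rw [integral_const_mul, integral_cexp_gaussian]
  have h (a b : Fin s → ℂ) := hΩ.inner_coherent hD a b 0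
  simp only [hD.zero_apply] at h
  rw [h, h, mul_left_comm, ← Complex.exp_add, ← Complex.exp_add]
  congr 2
  simp only [sub_dotProduct, dotProduct_sub, star_zero, dotProduct_zero, zero_dotProduct]
  ring

/-- Rank-one operators between coherent vectors are weak integrals of displacement operators. -/
lemma IsVacuum.integral_overlap_mul_inner (hD : IsWeylSystem D) (hΩ : IsVacuum D Ω)
    (a b : Fin s → ℂ) (x y : H) :
    ∫ w, ⟪D w (coherent D Ω a), coherent D Ω b⟫_ℂ * ⟪x, D w y⟫_ℂ =
      Real.pi ^ s * (⟪x, coherent D Ω b⟫_ℂ * ⟪coherent D Ω a, y⟫_ℂ) := by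
  set g : (Fin s → ℂ) → ℂ := fun w => ⟪D w (coherent D Ω a), coherent D Ω b⟫_ℂ with hg
  have hgi : Integrable g := hΩ.integrable_overlap hD a b
  have hint (y : H) : Integrable fun w => g w • D w y :=
    hgi.smul_bdd ‖y‖ (hD.continuous y).aestronglyMeasurable
      (.of_forall fun w => (hD.norm_apply w y).le)
  -- `G = ∫ g(w) D(w) dw` is defined vector by vector, since `D` is only strongly continuous. Being
  -- bounded, it is determined by its coherent matrix elements.
  let G : H →L[ℂ] H := LinearMap.mkContinuous
    { toFun := fun y => ∫ w, g w • D w y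
      map_add' := fun y z => by
        simp only [map_add, smul_add]
        exact integral_add (hint y) (hint z)
      map_smul' := fun c y => by
        simp only [map_smul, smul_comm _ c, RingHom.id_apply]
        exact integral_smul c _ } (∫ w, ‖g w‖) fun y => by
      refine (norm_integral_le_integral_norm _).trans_eq ?_
      simp only [norm_smul, hD.norm_apply]
      exact integral_mul_const _ _
  have hG (x y : H) : ⟪x, G y⟫_ℂ = ∫ w, g w * ⟪x, D w y⟫_ℂ := by
    refine (integral_inner (hint y) x).symm.trans ?_
    simp only [inner_smul_right]
  have key : G = (Real.pi ^ s : ℂ) •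
      InnerProductSpace.rankOne ℂ (coherent D Ω b) (coherent D Ω a) := by
    refine hΩ.ext_inner_clm hD fun c d => ?_
    rw [hG, hg, hΩ.integral_overlap_mul_overlap hD]
    simp only [smul_apply, InnerProductSpace.rankOne_apply, inner_smul_right]
    ring
  rw [← hG, key]
  simp only [smul_apply, InnerProductSpace.rankOne_apply, inner_smul_right]
  ring

lemma IsVacuum.memLp_overlap_of_mem_span (hD : IsWeylSystem D) (hΩ : IsVacuum D Ω)
    (a : Fin s → ℂ) {x : H} (hx : x ∈ Submodule.span ℂ (Set.range (coherent D Ω))) :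
    MemLp (fun w => ⟪D w (coherent D Ω a), x⟫_ℂ) 2 := by
  induction hx using Submodule.span_induction with
  | mem x hx =>
    obtain ⟨b, rfl⟩ := hx
    rw [memLp_two_iff_integrable_sq_norm
      ((hD.continuous _).inner continuous_const).aestronglyMeasurable]
    refine (hΩ.integrable_overlap_mul_overlap hD a b b a).norm.congr (.of_forall fun w => ?_)
    simp only [norm_mul]
    rw [← inner_conj_symm (coherent D Ω b), RCLike.norm_conj]
    ring
  | zero => simp
  | add x y _ _ hx hy => simp only [inner_add_right]; exact hx.add hy
  | smul c x _ hx => simp only [inner_smul_right]; exact hx.const_mul c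

lemma IsVacuum.integral_inner_mul_inner_of_mem_span (hD : IsWeylSystem D) (hΩ : IsVacuum D Ω)
    (a d : Fin s → ℂ) {x y : H} (hx : x ∈ Submodule.span ℂ (Set.range (coherent D Ω)))
    (hy : y ∈ Submodule.span ℂ (Set.range (coherent D Ω))) :
    ∫ w, ⟪D w (coherent D Ω a), x⟫_ℂ * ⟪y, D w (coherent D Ω d)⟫_ℂ =
      Real.pi ^ s * (⟪y, x⟫_ℂ * ⟪coherent D Ω a, coherent D Ω d⟫_ℂ) := by
  have hint {x y : H} (hx : x ∈ Submodule.span ℂ (Set.range (coherent D Ω)))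
      (hy : y ∈ Submodule.span ℂ (Set.range (coherent D Ω))) : Integrable fun w =>
      ⟪D w (coherent D Ω a), x⟫_ℂ * ⟪y, D w (coherent D Ω d)⟫_ℂ := by
    have h := (hΩ.memLp_overlap_of_mem_span hD a hx).integrable_mul
      (hΩ.memLp_overlap_of_mem_span hD d hy).star
    refine h.congr (.of_forall fun w => ?_)
    simp
  induction hx using Submodule.span_induction with
  | mem x hx =>
    obtain ⟨b, rfl⟩ := hx
    have hb : coherent D Ω b ∈ Submodule.span ℂ (Set.range (coherent D Ω)) :=
      Submodule.subset_span ⟨b, rfl⟩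
    induction hy using Submodule.span_induction with
    | mem y hy =>
      obtain ⟨c, rfl⟩ := hy
      exact hΩ.integral_overlap_mul_overlap hD a b c d
    | zero => simp
    | add y z hy hz ihy ihz =>
      simp only [inner_add_left, mul_add]
      rw [integral_add (hint hb hy) (hint hb hz), ihy, ihz]
      ring
    | smul c y _ ihy =>
      simp only [inner_smul_left, mul_left_comm _ (conj c)]
      rw [integral_const_mul, ihy]
      ring
  | zero => simp
  | add x z hx hz ihx ihz =>
    simp only [inner_add_right, add_mul]
    rw [integral_add (hint hx hy) (hint hz hy), ihx, ihz]
    ring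
  | smul c x _ ihx =>
    simp only [inner_smul_right, mul_assoc]
    rw [integral_const_mul, ihx]
    ring

/-- The orthogonality relation with `x = y` and `a = d` is an isometry statement, up to the factor
`√(π^s)`. -/
lemma IsVacuum.eLpNorm_overlap_of_mem_span (hD : IsWeylSystem D) (hΩ : IsVacuum D Ω)
    (a : Fin s → ℂ) {x : H} (hx : x ∈ Submodule.span ℂ (Set.range (coherent D Ω))) :
    eLpNorm (fun w => ⟪D w (coherent D Ω a), x⟫_ℂ) 2 =
      ENNReal.ofReal (√(Real.pi ^ s) * ‖x‖) := by
  have hm := hΩ.memLp_overlap_of_mem_span hD a hx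
  rw [← ENNReal.ofReal_toReal hm.eLpNorm_ne_top, ← Lp.norm_toLp _ hm]
  congr 1
  have h : ((‖hm.toLp _‖ ^ 2 : ℝ) : ℂ) = ((Real.pi ^ s * ‖x‖ ^ 2 : ℝ) : ℂ) := by
    push_cast
    rw [← RCLike.ofReal_eq_complex_ofReal, ← inner_self_eq_norm_sq_to_K, L2.inner_def]
    have h2 := hΩ.integral_inner_mul_inner_of_mem_span hD a a hx hx
    rw [inner_self_eq_norm_sq_to_K, inner_self_eq_norm_sq_to_K, hΩ.norm_coherent hD] at h2
    simp only [Complex.coe_algebraMap, Complex.ofReal_one, one_pow, mul_one] at h2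
    refine Eq.trans (integral_congr_ae ?_) h2
    filter_upwards [hm.coeFn_toLp] with w hw
    rw [hw, RCLike.inner_apply, inner_conj_symm]
  have h' : ‖hm.toLp _‖ ^ 2 = (√(Real.pi ^ s) * ‖x‖) ^ 2 := by
    rw [mul_pow, Real.sq_sqrt (by positivity)]
    exact_mod_cast h
  exact (pow_left_inj₀ (norm_nonneg _) (by positivity) two_ne_zero).mp h'

/-- Fatou's lemma along a sequence in the dense span. This gives square integrability for arbitrary
`x`, where no Gaussian decay is at hand. -/
lemma IsVacuum.eLpNorm_overlap_le (hD : IsWeylSystem D) (hΩ : IsVacuum D Ω)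
    (a : Fin s → ℂ) (x : H) :
    eLpNorm (fun w => ⟪D w (coherent D Ω a), x⟫_ℂ) 2 ≤
      ENNReal.ofReal (√(Real.pi ^ s) * ‖x‖) := by
  obtain ⟨u, hu, hux⟩ := mem_closure_iff_seq_limit.mp (hΩ.dense_span_coherent hD x)
  have h := Lp.eLpNorm_lim_le_liminf_eLpNorm (p := 2) (μ := volume)
    (f := fun n w => ⟪D w (coherent D Ω a), u n⟫_ℂ)
    (fun n => ((hD.continuous _).inner continuous_const).aestronglyMeasurable)
    (fun w => ⟪D w (coherent D Ω a), x⟫_ℂ)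
    (.of_forall fun w => tendsto_const_nhds.inner hux)
  refine h.trans_eq ?_
  simp only [fun n => hΩ.eLpNorm_overlap_of_mem_span hD a (hu n)]
  exact (ENNReal.tendsto_ofReal (hux.norm.const_mul _)).liminf_eq

lemma IsVacuum.memLp_overlap (hD : IsWeylSystem D) (hΩ : IsVacuum D Ω)
    (a : Fin s → ℂ) (x : H) :
    MemLp (fun w => ⟪D w (coherent D Ω a), x⟫_ℂ) 2 :=
  ⟨((hD.continuous _).inner continuous_const).aestronglyMeasurable,
    (hΩ.eLpNorm_overlap_le hD a x).trans_lt ENNReal.ofReal_lt_top⟩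

/-- The coherent state transform `x ↦ (w ↦ ⟨D(w) a, x⟩)` into `L²(ℂ^s)`. -/
def IsVacuum.transform (hD : IsWeylSystem D) (hΩ : IsVacuum D Ω) (a : Fin s → ℂ) :
    H →L[ℂ] Lp ℂ 2 (volume : Measure (Fin s → ℂ)) :=
  LinearMap.mkContinuous
    { toFun := fun x => (hΩ.memLp_overlap hD a x).toLp _
      map_add' := fun x y => by
        rw [← MemLp.toLp_add, MemLp.toLp_eq_toLp_iff]
        exact .of_forall fun w => inner_add_right _ _ _
      map_smul' := fun c x => by
        rw [RingHom.id_apply, ← MemLp.toLp_const_smul, MemLp.toLp_eq_toLp_iff]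
        exact .of_forall fun w => inner_smul_right _ _ _ } (√(Real.pi ^ s)) fun x => by
      refine (Lp.norm_toLp _ (hΩ.memLp_overlap hD a x)).trans_le ?_
      exact ENNReal.toReal_le_of_le_ofReal (by positivity) (hΩ.eLpNorm_overlap_le hD a x)

lemma IsVacuum.inner_transform (hD : IsWeylSystem D) (hΩ : IsVacuum D Ω) (a d : Fin s → ℂ)
    (x y : H) :
    ⟪hΩ.transform hD d y, hΩ.transform hD a x⟫_ℂ =
      ∫ w, ⟪D w (coherent D Ω a), x⟫_ℂ * ⟪y, D w (coherent D Ω d)⟫_ℂ := by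
  rw [L2.inner_def]
  refine integral_congr_ae ?_
  filter_upwards [(hΩ.memLp_overlap hD a x).coeFn_toLp,
    (hΩ.memLp_overlap hD d y).coeFn_toLp] with w h1 h2
  refine (congrArg₂ (fun p q => ⟪p, q⟫_ℂ) h2 h1).trans ?_
  rw [RCLike.inner_apply, inner_conj_symm]

/-- Orthogonality relations for matrix elements between arbitrary and coherent vectors. -/
lemma IsVacuum.integral_inner_mul_inner (hD : IsWeylSystem D) (hΩ : IsVacuum D Ω)
    (a d : Fin s → ℂ) (x y : H) :
    ∫ w, ⟪D w (coherent D Ω a), x⟫_ℂ * ⟪y, D w (coherent D Ω d)⟫_ℂ =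
      Real.pi ^ s * (⟪y, x⟫_ℂ * ⟪coherent D Ω a, coherent D Ω d⟫_ℂ) := by
  -- Both sides are bounded operators, so agreement on coherent vectors, where it is a Gaussian
  -- integral, suffices.
  have key : (hΩ.transform hD d).adjoint ∘L hΩ.transform hD a =
      (Real.pi ^ s * ⟪coherent D Ω a, coherent D Ω d⟫_ℂ : ℂ) • (1 : H →L[ℂ] H) := by
    refine hΩ.ext_inner_clm hD fun c b => ?_
    rw [ContinuousLinearMap.comp_apply, ContinuousLinearMap.adjoint_inner_right,
      hΩ.inner_transform hD, hΩ.integral_overlap_mul_overlap hD, smul_apply,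
      one_apply_eq_self, inner_smul_right]
    ring
  rw [← hΩ.inner_transform hD, ← ContinuousLinearMap.adjoint_inner_right,
    ← ContinuousLinearMap.comp_apply, key, smul_apply, one_apply_eq_self, inner_smul_right]
  ring

lemma IsVacuum.integrable_inner_mul_inner (hD : IsWeylSystem D) (hΩ : IsVacuum D Ω)
    (a d : Fin s → ℂ) (x y : H) :
    Integrable fun w => ⟪D w (coherent D Ω a), x⟫_ℂ * ⟪y, D w (coherent D Ω d)⟫_ℂ := by
  have h := (hΩ.memLp_overlap hD a x).integrable_mul (hΩ.memLp_overlap hD d y).star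
  refine h.congr (.of_forall fun w => ?_)
  simp

end Moyal

/-! ### Hilbert-Schmidt sums. -/

section HilbertSchmidt

lemma hasSum_norm_inner_sq {ι H : Type*} [NormedAddCommGroup H] [InnerProductSpace ℂ H]
    (b : HilbertBasis ι ℂ H) (x : H) : HasSum (fun i => ‖⟪b i, x⟫_ℂ‖ ^ 2) (‖x‖ ^ 2) := by
  have h := b.hasSum_inner_mul_inner x x
  have e (i : ι) : ⟪x, b i⟫_ℂ * ⟪b i, x⟫_ℂ = ((‖⟪b i, x⟫_ℂ‖ ^ 2 : ℝ) : ℂ) := by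
    rw [← inner_conj_symm, RCLike.conj_mul]
    simp
  have e' : ⟪x, x⟫_ℂ = ((‖x‖ ^ 2 : ℝ) : ℂ) := by
    rw [inner_self_eq_norm_sq_to_K]
    simp
  simp only [e, e'] at h
  exact Complex.hasSum_ofReal.mp h

lemma summable_norm_inner_sq_prod {ι H : Type*} [NormedAddCommGroup H] [InnerProductSpace ℂ H]
    (b : HilbertBasis ι ℂ H) {A : H →L[ℂ] H}
    (hA : Summable fun i => ‖A (b i)‖ ^ 2) :
    Summable fun p : ι × ι => ‖⟪b p.2, A (b p.1)⟫_ℂ‖ ^ 2 := by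
  rw [summable_prod_of_nonneg fun p => sq_nonneg _]
  refine ⟨fun i => (hasSum_norm_inner_sq b (A (b i))).summable, ?_⟩
  exact hA.congr fun i => (hasSum_norm_inner_sq b (A (b i))).tsum_eq.symm

/-- Symmetry of the Hilbert-Schmidt inner product under taking adjoints. -/
lemma tsum_inner_eq_tsum_inner_adjoint {ι H : Type*} [NormedAddCommGroup H]
    [InnerProductSpace ℂ H] [CompleteSpace H] (b : HilbertBasis ι ℂ H) {A B : H →L[ℂ] H}
    (hA : Summable fun i => ‖A.adjoint (b i)‖ ^ 2) (hB : Summable fun i => ‖B.adjoint (b i)‖ ^ 2) :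
    ∑' i, ⟪A (b i), B (b i)⟫_ℂ = ∑' i, ⟪B.adjoint (b i), A.adjoint (b i)⟫_ℂ := by
  -- Absolute summability of the double series, from `|αβ| ≤ |α|² + |β|²`, allows the sums to be
  -- exchanged.
  have hsum : Summable fun p : ι × ι =>
      ⟪B.adjoint (b p.1), b p.2⟫_ℂ * ⟪b p.2, A.adjoint (b p.1)⟫_ℂ := by
    refine .of_norm_bounded
      ((summable_norm_inner_sq_prod b hA).add (summable_norm_inner_sq_prod b hB)) fun p => ?_
    rw [norm_mul, norm_inner_symm]
    nlinarith [sq_nonneg (‖⟪b p.2, A.adjoint (b p.1)⟫_ℂ‖ - ‖⟪b p.2, B.adjoint (b p.1)⟫_ℂ‖),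
      sq_nonneg ‖⟪b p.2, A.adjoint (b p.1)⟫_ℂ‖, sq_nonneg ‖⟪b p.2, B.adjoint (b p.1)⟫_ℂ‖]
  calc ∑' i, ⟪A (b i), B (b i)⟫_ℂ
      = ∑' i, ∑' j, ⟪B.adjoint (b j), b i⟫_ℂ * ⟪b i, A.adjoint (b j)⟫_ℂ := by
        refine tsum_congr fun i => ?_
        rw [← b.tsum_inner_mul_inner]
        refine tsum_congr fun j => ?_
        rw [ContinuousLinearMap.adjoint_inner_left, ContinuousLinearMap.adjoint_inner_right,
          mul_comm]
    _ = ∑' j, ∑' i, ⟪B.adjoint (b j), b i⟫_ℂ * ⟪b i, A.adjoint (b j)⟫_ℂ :=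
        Summable.tsum_comm hsum
    _ = _ := tsum_congr fun j => b.tsum_inner_mul_inner _ _

end HilbertSchmidt

/-! ### Positive operators of finite trace as countable sums of rank-one operators. -/

section Trace

universe u

variable {H : Type u} [NormedAddCommGroup H] [InnerProductSpace ℂ H] [CompleteSpace H]

/-- A positive operator `T` with `∑ᵢ ⟨bᵢ, T bᵢ⟩ < ∞` is a countable sum of rank-one operators
`|xᵢ⟩⟨xᵢ|`, and its products with bounded operators are traced termwise. -/
lemma exists_decomposition_of_summable {κ : Type*} (b : HilbertBasis κ ℂ H) {T : H →L[ℂ] H}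
    (hpos : T.IsPositive) (hsum : Summable fun i => ⟪b i, T (b i)⟫_ℂ) :
    ∃ (N : Set κ) (_ : Countable N) (x : N → H), Summable (fun i => ‖x i‖ ^ 2) ∧
      (∀ X : H →L[ℂ] H,
        HasSum (fun i => ⟪x i, X (x i)⟫_ℂ) (∑' i, ⟪b i, (T * X) (b i)⟫_ℂ)) ∧
      ∀ y z : H, HasSum (fun i => ⟪y, x i⟫_ℂ * ⟪x i, z⟫_ℂ) ⟪y, T z⟫_ℂ := by
  -- The vectors are `x_i = √T b_i`; cyclicity of the trace for the Hilbert-Schmidt pair `√T`, `√T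
  -- X` gives the trace formula.
  let S := CFC.sqrt T
  have hTn : 0 ≤ T := (ContinuousLinearMap.nonneg_iff_isPositive T).mpr hpos
  have hSS : S * S = T := CFC.sqrt_mul_sqrt_self T hTn
  have hSadj : S.adjoint = S :=
    ((ContinuousLinearMap.nonneg_iff_isPositive S).mp (CFC.sqrt_nonneg T)).isSelfAdjoint.adjoint_eq
  have hSym (x y : H) : ⟪S x, y⟫_ℂ = ⟪x, S y⟫_ℂ := by
    rw [← ContinuousLinearMap.adjoint_inner_right, hSadj]
  have hT' (x y : H) : ⟪x, T y⟫_ℂ = ⟪S x, S y⟫_ℂ := by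
    rw [hSym, ← hSS]; rfl
  have hx : Summable fun i => ‖S (b i)‖ ^ 2 := by
    rw [← Complex.summable_ofReal]
    refine hsum.congr fun i => ?_
    rw [hT', inner_self_eq_norm_sq_to_K]
    simp
  -- Discarding the zero vectors leaves a countable index set, as needed for exchanging sums with
  -- integrals.
  let N := Function.support fun i => ‖S (b i)‖ ^ 2
  have hN (i) (hi : S (b i) ≠ 0) : i ∈ N := by simpa [N] using hi
  refine ⟨N, hx.countable_support.to_subtype, fun i => S (b i), hx.subtype N, fun X => ?_,
    fun y z => ?_⟩
  · have hsupp : Function.support (fun i => ⟪S (b i), X (S (b i))⟫_ℂ) ⊆ N := fun i hi =>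
      hN i fun h => hi (by simp [h])
    refine (hasSum_subtype_iff_of_support_subset hsupp).mpr ?_
    have hs : Summable fun i => ⟪S (b i), X (S (b i))⟫_ℂ := by
      refine .of_norm_bounded (hx.mul_left ‖X‖) fun i => ?_
      refine (norm_inner_le_norm _ _).trans ?_
      have := X.le_opNorm (S (b i))
      nlinarith [norm_nonneg (S (b i))]
    refine (congrArg (HasSum _) ?_).mpr hs.hasSum
    have hB : (S * X).adjoint = X.adjoint * S := by
      have := star_mul S X
      rw [ContinuousLinearMap.star_eq_adjoint, ContinuousLinearMap.star_eq_adjoint,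
        ContinuousLinearMap.star_eq_adjoint, hSadj] at this
      exact this
    have h := tsum_inner_eq_tsum_inner_adjoint b (A := S) (B := S * X) (by rwa [hSadj]) (by
      rw [hB]
      refine .of_nonneg_of_le (fun i => sq_nonneg _) (fun i => ?_)
        (hx.mul_left (‖X.adjoint‖ ^ 2))
      rw [← mul_pow]
      exact pow_le_pow_left₀ (norm_nonneg _) (X.adjoint.le_opNorm _) 2)
    rw [hB, hSadj] at h
    refine Eq.trans (tsum_congr fun i => ?_) (h.trans (tsum_congr fun i => ?_))
    · exact hT' _ _
    · rw [mul_apply_eq_comp]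
      exact X.adjoint_inner_left (S (b i)) (S (b i))
  · have hsupp : Function.support (fun i => ⟪y, S (b i)⟫_ℂ * ⟪S (b i), z⟫_ℂ) ⊆ N := fun i hi =>
      hN i fun h => hi (by simp [h])
    refine (hasSum_subtype_iff_of_support_subset hsupp).mpr ?_
    have h := b.hasSum_inner_mul_inner (S y) (S z)
    rw [← hT'] at h
    simp only [hSym y, ← hSym _ z] at h
    exact h

lemma IsPositiveFiniteTrace.exists_decomposition {T : H →L[ℂ] H} (hT : IsPositiveFiniteTrace T) :
    ∃ (ι : Type u) (_ : Countable ι) (x : ι → H), Summable (fun i => ‖x i‖ ^ 2) ∧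
      (∀ X : H →L[ℂ] H, HasSum (fun i => ⟪x i, X (x i)⟫_ℂ) (trace (T * X))) ∧
      ∀ y z : H, HasSum (fun i => ⟪y, x i⟫_ℂ * ⟪x i, z⟫_ℂ) ⟪y, T z⟫_ℂ := by
  obtain ⟨N, hN, x, h⟩ :=
    exists_decomposition_of_summable (exists_hilbertBasis ℂ H).choose_spec.choose hT.1 hT.2
  exact ⟨N, hN, x, h⟩

/-- A divergent `tsum` has the default value `0`, so a nonzero trace certifies summability. -/
lemma IsPositive.isPositiveFiniteTrace_of_trace_ne_zero {T : H →L[ℂ] H} (hT : T.IsPositive)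
    (h : trace T ≠ 0) : IsPositiveFiniteTrace T :=
  ⟨hT, by_contra fun hs => h (tsum_eq_zero_of_not_summable hs)⟩

end Trace

/-! ### Channels preserve states. -/

section Channel

variable {HA HB : Type*} [NormedAddCommGroup HA] [InnerProductSpace ℂ HA] [CompleteSpace HA]
  [NormedAddCommGroup HB] [InnerProductSpace ℂ HB] [CompleteSpace HB]

lemma IsState.isPositiveFiniteTrace {ρ : traceClass HA} (hρ : IsState ρ) :
    IsPositiveFiniteTrace (ρ : HA →L[ℂ] HA) :=
  IsPositive.isPositiveFiniteTrace_of_trace_ne_zero hρ.1 (by simp [hρ.2])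

open scoped ComplexOrder in
lemma IsChannel.isState {Φ : traceClass HA →ₗ[ℂ] traceClass HB} (hΦ : IsChannel Φ)
    {ρ : traceClass HA} (hρ : IsState ρ) : IsState (Φ ρ) := by
  refine ⟨?_, by rw [hΦ.trace_map, hρ.2]⟩
  rw [ContinuousLinearMap.isPositive_iff_complex]
  intro y
  -- Positivity is complete positivity for `1 × 1` operator matrices.
  have h := hΦ.completelyPositive 1 (fun _ _ => ρ)
    (fun x => by simpa using hρ.1.inner_nonneg_right (x 0)) (fun _ => y)
  simp only [Finset.univ_unique, Finset.sum_const, Finset.card_singleton, one_smul] at h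
  have h' := inner_conj_symm (𝕜 := ℂ) ((Φ ρ : HB →L[ℂ] HB) y) y
  rw [Complex.conj_eq_iff_im.mpr (Complex.nonneg_iff.mp h).2.symm] at h'
  rw [← h']
  exact ⟨Complex.ext rfl (Complex.nonneg_iff.mp h).2, (Complex.nonneg_iff.mp h).1⟩

end Channel

/-! ### Positivity of the heterodyne density. -/

section HeterodyneDensity

variable {s : ℕ} {H : Type*} [NormedAddCommGroup H] [InnerProductSpace ℂ H]
  {D : (Fin s → ℂ) → (H →L[ℂ] H)} {Ω : H}

lemma heterodyneDensity_nonneg {ρ : H →L[ℂ] H} (hρ : ρ.IsPositive) (z : Fin s → ℂ) :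
    0 ≤ heterodyneDensity D Ω ρ z :=
  mul_nonneg (by positivity) (hρ.re_inner_nonneg_right _)

lemma ofReal_heterodyneDensity {ρ : H →L[ℂ] H} (hρ : ρ.IsPositive) (z : Fin s → ℂ) :
    (heterodyneDensity D Ω ρ z : ℂ) =
      (Real.pi ^ s : ℂ)⁻¹ * ⟪coherent D Ω z, ρ (coherent D Ω z)⟫_ℂ := by
  have h : (⟪coherent D Ω z, ρ (coherent D Ω z)⟫_ℂ).im = 0 := by
    rw [← Complex.conj_eq_iff_im, inner_conj_symm]
    exact hρ.isSymmetric _ _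
  rw [heterodyneDensity]
  push_cast
  congr 1
  exact Complex.ext (by simp) (by simp [h])

end HeterodyneDensity

/-! ### Inversion formula and Fourier transform of the heterodyne density. -/

section CharacteristicFunction

variable {s : ℕ} {H : Type*} [NormedAddCommGroup H] [InnerProductSpace ℂ H] [CompleteSpace H]
  {D : (Fin s → ℂ) → (H →L[ℂ] H)} {Ω : H}

lemma coherent_zero (hD : IsWeylSystem D) : coherent D Ω 0 = Ω := hD.zero_apply Ω

lemma trace_smul (c : ℂ) (T : H →L[ℂ] H) : trace (c • T) = c * trace T := by
  simp [trace, tsum_mul_left]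

/-- A positive operator of finite trace is recovered from its characteristic function. -/
lemma IsVacuum.integral_overlap_mul_trace (hD : IsWeylSystem D) (hΩ : IsVacuum D Ω)
    {T : H →L[ℂ] H} (hT : IsPositiveFiniteTrace T) (a b : Fin s → ℂ) :
    ∫ w, ⟪D w (coherent D Ω a), coherent D Ω b⟫_ℂ * trace (T * D w) =
      Real.pi ^ s * ⟪coherent D Ω a, T (coherent D Ω b)⟫_ℂ := by
  obtain ⟨ι, _, x, hx, htr, hinner⟩ := hT.exists_decomposition
  have hgi := hΩ.integrable_overlap hD a b
  set g : (Fin s → ℂ) → ℂ := fun w => ⟪D w (coherent D Ω a), coherent D Ω b⟫_ℂ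
  -- With `x_i` decomposing `T`, this bound and the integrability of `g` justify integrating the
  -- trace series term by term.
  have hbound (i : ι) (w : Fin s → ℂ) : ‖⟪x i, D w (x i)⟫_ℂ‖ ≤ ‖x i‖ ^ 2 := by
    refine (norm_inner_le_norm _ _).trans_eq ?_
    rw [hD.norm_apply, sq]
  have hint (i : ι) : Integrable fun w => g w * ⟪x i, D w (x i)⟫_ℂ :=
    hgi.mul_bdd (hD.continuous_inner _ _).aestronglyMeasurable (.of_forall (hbound i))
  have h := hasSum_integral_of_summable_integral_norm hint (by
    refine .of_nonneg_of_le (fun i => integral_nonneg fun w => norm_nonneg _) (fun i => ?_)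
      (hx.mul_left (∫ w, ‖g w‖))
    rw [← integral_mul_const]
    refine integral_mono (hint i).norm (hgi.norm.mul_const _) fun w => ?_
    simp only [norm_mul]
    exact mul_le_mul_of_nonneg_left (hbound i w) (norm_nonneg _))
  simp only [tsum_mul_left, fun w => (htr (D w)).tsum_eq] at h
  refine h.tsum_eq.symm.trans ((tsum_congr fun i => ?_).trans
    ((hinner (coherent D Ω a) (coherent D Ω b)).mul_left (Real.pi ^ s : ℂ)).tsum_eq)
  rw [hΩ.integral_overlap_mul_inner hD, mul_comm ⟪x i, _⟫_ℂ]

/-- The Fourier transform of the heterodyne density is the characteristic function of the state,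
damped by a Gaussian. -/
lemma IsVacuum.integral_heterodyneDensity_mul_cexp (hD : IsWeylSystem D) (hΩ : IsVacuum D Ω)
    {ρ : H →L[ℂ] H} (hρ : IsPositiveFiniteTrace ρ) (v : Fin s → ℂ) :
    ∫ u, (heterodyneDensity D Ω ρ u : ℂ) * Complex.exp (star u ⬝ᵥ v - star v ⬝ᵥ u) =
      Complex.exp (-(star v ⬝ᵥ v) / 2) * trace (ρ * D v) := by
  obtain ⟨ι, _, x, hx, htr, hinner⟩ := hρ.exists_decomposition
  -- Conjugating `D u` by `D v` only produces the Fourier phase. The phase is thus absorbed into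
  -- displaced vectors, and the orthogonality relation applies with `a = 0`, `d = -v`, yielding `⟪x
  -- i, D v (x i)⟫` times the vacuum Gaussian at `v`.
  have hphase (y : H) (u : Fin s → ℂ) : ⟪D (-v) y, D u (coherent D Ω (-v))⟫_ℂ =
      Complex.exp (star u ⬝ᵥ v - star v ⬝ᵥ u) * ⟪y, D u (coherent D Ω 0)⟫_ℂ := by
    rw [hD.inner_apply_left, neg_neg, coherent, coherent_zero hD, hD.apply_apply u, map_smul,
      hD.apply_apply, smul_smul, inner_smul_right, ← Complex.exp_add]
    simp only [star_neg, dotProduct_neg, neg_dotProduct, dotProduct_add, add_dotProduct, star_add]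
    congr 2
    · ring
    · congr 3
      abel
  have hphase_norm (u : Fin s → ℂ) : ‖Complex.exp (star u ⬝ᵥ v - star v ⬝ᵥ u)‖ = 1 := by
    rw [Complex.norm_exp, ← conj_star_dotProduct v u]
    simp
  have hint (i : ι) := hΩ.integrable_inner_mul_inner hD 0 (-v) (x i) (D (-v) (x i))
  have hnorm (i : ι) : ∫ u, ‖⟪D u (coherent D Ω 0), x i⟫_ℂ *
      ⟪D (-v) (x i), D u (coherent D Ω (-v))⟫_ℂ‖ = Real.pi ^ s * ‖x i‖ ^ 2 := by
    have h := hΩ.integral_inner_mul_inner hD 0 0 (x i) (x i)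
    rw [inner_self_eq_norm_sq_to_K, inner_self_eq_norm_sq_to_K, hΩ.norm_coherent hD] at h
    rw [← Complex.ofReal_inj, ← integral_complex_ofReal]
    push_cast
    refine Eq.trans (integral_congr_ae (.of_forall fun u => ?_)) (h.trans (by simp))
    simp only [hphase, norm_mul, hphase_norm, one_mul]
    rw [← inner_conj_symm (x i), RCLike.norm_conj, RCLike.mul_conj]
    simp [sq]
  have h := hasSum_integral_of_summable_integral_norm hint (by
    simp only [hnorm]
    exact hx.mul_left _)
  have hpt (u : Fin s → ℂ) : ∑' i, ⟪D u (coherent D Ω 0), x i⟫_ℂ *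
      ⟪D (-v) (x i), D u (coherent D Ω (-v))⟫_ℂ = Real.pi ^ s *
      ((heterodyneDensity D Ω ρ u : ℂ) * Complex.exp (star u ⬝ᵥ v - star v ⬝ᵥ u)) := by
    simp only [hphase, mul_left_comm _ (Complex.exp _), tsum_mul_left]
    rw [(hinner _ _).tsum_eq, ofReal_heterodyneDensity hρ.1, coherent_zero hD, coherent]
    field_simp [Real.pi_ne_zero]
  simp only [hpt, integral_const_mul] at h
  have h' := ((htr (D v)).mul_left (Complex.exp (-(star v ⬝ᵥ v) / 2))).mul_left (Real.pi ^ s : ℂ)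
  refine mul_left_cancel₀ (pow_ne_zero s (Complex.ofReal_ne_zero.mpr Real.pi_ne_zero))
    (h.tsum_eq.symm.trans ((tsum_congr fun i => ?_).trans h'.tsum_eq))
  rw [hΩ.integral_inner_mul_inner hD, hD.inner_apply_left, neg_neg, coherent_zero hD, coherent,
    hΩ.inner_apply hD]
  simp only [star_neg, dotProduct_neg, neg_dotProduct, neg_neg]
  ring

lemma IsVacuum.integral_heterodyneDensity (hD : IsWeylSystem D) (hΩ : IsVacuum D Ω)
    {ρ : traceClass H} (hρ : IsState ρ) : ∫ u, heterodyneDensity D Ω ρ u = 1 := by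
  have h := hΩ.integral_heterodyneDensity_mul_cexp hD hρ.isPositiveFiniteTrace 0
  have h0 : D 0 = 1 := ContinuousLinearMap.ext fun x => hD.zero_apply x
  simp only [dotProduct_zero, star_zero, zero_dotProduct, sub_self, Complex.exp_zero, mul_one,
    h0, hρ.2, neg_zero, zero_div] at h
  rw [integral_complex_ofReal] at h
  exact_mod_cast h

end CharacteristicFunction

/-! ### Matching the channel with the measure-reprepare map. -/

section MeasureReprepare

variable {sA sB : ℕ} {HA HB : Type*} [NormedAddCommGroup HA] [InnerProductSpace ℂ HA]
  [CompleteSpace HA] [NormedAddCommGroup HB] [InnerProductSpace ℂ HB] [CompleteSpace HB]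
  {DA : (Fin sA → ℂ) → (HA →L[ℂ] HA)} {DB : (Fin sB → ℂ) → (HB →L[ℂ] HB)} {ΩA : HA} {ΩB : HB}

/-- The minimal noise is exactly the vacuum noise of the output coherent states plus the Gaussian
damping of the heterodyne measurement. -/
lemma star_dotProduct_one_add_mul_conjTranspose_mulVec (K : Matrix (Fin sB) (Fin sA) ℂ)
    (w : Fin sB → ℂ) :
    star w ⬝ᵥ ((1 / 2 : ℂ) • (1 + K * Kᴴ)) *ᵥ w =
      (star w ⬝ᵥ w) / 2 + (star (Kᵀ *ᵥ star w) ⬝ᵥ (Kᵀ *ᵥ star w)) / 2 := by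
  rw [Matrix.mulVec_transpose, Matrix.star_vecMul, star_star, Matrix.smul_mulVec,
    Matrix.add_mulVec, Matrix.one_mulVec, ← Matrix.mulVec_mulVec, dotProduct_smul,
    dotProduct_add, Matrix.dotProduct_mulVec, dotProduct_comm (star w ᵥ* K)]
  simp only [smul_eq_mul]
  ring

/-- The label `-K conj u` is chosen so that the phase is the Fourier kernel at `K^t conj w`. -/
lemma IsVacuum.inner_coherent_neg_mulVec (hDB : IsWeylSystem DB) (hΩB : IsVacuum DB ΩB)
    (K : Matrix (Fin sB) (Fin sA) ℂ) (u : Fin sA → ℂ) (w : Fin sB → ℂ) :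
    ⟪coherent DB ΩB (-(K *ᵥ star u)), DB w (coherent DB ΩB (-(K *ᵥ star u)))⟫_ℂ =
      Complex.exp (-(star w ⬝ᵥ w) / 2 +
        (star u ⬝ᵥ (Kᵀ *ᵥ star w) - star (Kᵀ *ᵥ star w) ⬝ᵥ u)) := by
  have h : star w ⬝ᵥ (K *ᵥ star u) = star u ⬝ᵥ (Kᵀ *ᵥ star w) := by
    rw [Matrix.dotProduct_mulVec, Matrix.mulVec_transpose, dotProduct_comm]
  rw [hΩB.inner_coherent hDB]
  congr 1
  simp only [star_neg, neg_dotProduct, dotProduct_neg]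
  rw [← conj_star_dotProduct w (K *ᵥ star u), h, conj_star_dotProduct]
  ring

lemma continuous_coherentProj (hDB : IsWeylSystem DB) : Continuous (coherentProj DB ΩB) := by
  exact ((ContinuousLinearMap.smulRightL ℂ HB HB).continuous.comp
    ((innerSL ℂ).continuous.comp (hDB.continuous ΩB))).clm_apply (hDB.continuous ΩB)

lemma IsVacuum.norm_coherentProj (hDB : IsWeylSystem DB) (hΩB : IsVacuum DB ΩB)
    (z : Fin sB → ℂ) : ‖coherentProj DB ΩB z‖ = 1 := by
  rw [coherentProj, InnerProductSpace.norm_rankOne, hΩB.norm_coherent hDB, one_mul]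

lemma IsVacuum.integrable_smul_coherentProj (hDB : IsWeylSystem DB) (hΩB : IsVacuum DB ΩB)
    (K : Matrix (Fin sB) (Fin sA) ℂ) {p : (Fin sA → ℂ) → ℝ} (hp : Integrable p) :
    Integrable fun z => (p z : ℂ) • coherentProj DB ΩB (-(K *ᵥ star z)) := by
  refine Integrable.smul_bdd (𝕜 := ℂ) (φ := fun z => (p z : ℂ)) hp.ofReal 1 ?_
    (.of_forall fun z => (hΩB.norm_coherentProj hDB _).le)
  exact ((continuous_coherentProj hDB).comp
    (continuous_const.matrix_mulVec continuous_star).neg).aestronglyMeasurable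

/-- Fubini hypothesis for the final exchange: an integrable product of functions of separate
variables, times a factor of modulus at most `1`. -/
lemma IsVacuum.integrable_overlap_mul_density (hDB : IsWeylSystem DB) (hΩB : IsVacuum DB ΩB)
    (K : Matrix (Fin sB) (Fin sA) ℂ) {p : (Fin sA → ℂ) → ℝ} (hp : Integrable p)
    (a b : Fin sB → ℂ) :
    Integrable (fun x : (Fin sB → ℂ) × (Fin sA → ℂ) =>
      (⟪DB x.1 (coherent DB ΩB a), coherent DB ΩB b⟫_ℂ * (p x.2 : ℂ)) *
      ⟪coherent DB ΩB (-(K *ᵥ star x.2)),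
        DB x.1 (coherent DB ΩB (-(K *ᵥ star x.2)))⟫_ℂ) (volume.prod volume) := by
  refine ((hΩB.integrable_overlap hDB a b).mul_prod hp.ofReal).mul_bdd (c := 1) ?_
    (.of_forall fun x => ?_)
  · simp only [hΩB.inner_coherent_neg_mulVec hDB]
    refine Continuous.aestronglyMeasurable ?_
    have h : Continuous fun x : (Fin sB → ℂ) × (Fin sA → ℂ) => Kᵀ *ᵥ star x.1 :=
      continuous_const.matrix_mulVec continuous_fst.star
    exact Complex.continuous_exp.comp
      (((continuous_fst.star.dotProduct continuous_fst).neg.div_const 2).add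
        ((continuous_snd.star.dotProduct h).sub (h.star.dotProduct continuous_snd)))
  · refine (norm_inner_le_norm _ _).trans_eq ?_
    rw [hDB.norm_apply, hΩB.norm_coherent hDB, one_mul]

lemma IsQuantumLimitedContravariant.trace_map_mul (hDA : IsWeylSystem DA)
    (hΩA : IsVacuum DA ΩA) (hDB : IsWeylSystem DB) (hΩB : IsVacuum DB ΩB)
    {K : Matrix (Fin sB) (Fin sA) ℂ} {Φ : traceClass HA →ₗ[ℂ] traceClass HB}
    (hΦ : IsQuantumLimitedContravariant DA DB K Φ) {ρ : traceClass HA} (hρ : IsState ρ)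
    (w : Fin sB → ℂ) :
    trace ((Φ ρ : HB →L[ℂ] HB) * DB w) = ∫ u, (heterodyneDensity DA ΩA ρ u : ℂ) *
      ⟪coherent DB ΩB (-(K *ᵥ star u)), DB w (coherent DB ΩB (-(K *ᵥ star u)))⟫_ℂ := by
  have h := hΩA.integral_heterodyneDensity_mul_cexp hDA hρ.isPositiveFiniteTrace (Kᵀ *ᵥ star w)
  rw [hΦ.adjoint_displacement w ρ, mul_smul_comm, trace_smul,
    star_dotProduct_one_add_mul_conjTranspose_mulVec, neg_add, Complex.exp_add, mul_assoc,
    ← neg_div (2 : ℂ) (star (Kᵀ *ᵥ star w) ⬝ᵥ (Kᵀ *ᵥ star w)), ← h, ← integral_const_mul]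
  refine integral_congr_ae (.of_forall fun u => ?_)
  simp only [hΩB.inner_coherent_neg_mulVec hDB, Complex.exp_add, neg_div]
  ring

end MeasureReprepare

end

end Bosonic

theorem proposition5 {sA sB : ℕ} {HA HB : Type*}
    [NormedAddCommGroup HA] [InnerProductSpace ℂ HA] [CompleteSpace HA]
    [NormedAddCommGroup HB] [InnerProductSpace ℂ HB] [CompleteSpace HB]
    (DA : (Fin sA → ℂ) → (HA →L[ℂ] HA)) (hDA : Bosonic.IsWeylSystem DA)
    (DB : (Fin sB → ℂ) → (HB →L[ℂ] HB)) (hDB : Bosonic.IsWeylSystem DB)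
    (ΩA : HA) (hΩA : Bosonic.IsVacuum DA ΩA)
    (ΩB : HB) (hΩB : Bosonic.IsVacuum DB ΩB)
    (K : Matrix (Fin sB) (Fin sA) ℂ)
    (Φ : Bosonic.traceClass HA →ₗ[ℂ] Bosonic.traceClass HB)
    (hΦ : Bosonic.IsQuantumLimitedContravariant DA DB K Φ)
    (ρ : Bosonic.traceClass HA) (hρ : Bosonic.IsState ρ) :
    (∀ z, 0 ≤ Bosonic.heterodyneDensity DA ΩA ρ z) ∧
    MeasureTheory.Integrable (Bosonic.heterodyneDensity DA ΩA ρ) ∧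
    ∫ z, Bosonic.heterodyneDensity DA ΩA ρ z = 1 ∧
    MeasureTheory.Integrable (fun z : Fin sA → ℂ =>
      (Bosonic.heterodyneDensity DA ΩA ρ z : ℂ) •
        Bosonic.coherentProj DB ΩB (-(K.mulVec (star z)))) ∧
    (Φ ρ : HB →L[ℂ] HB) =
      ∫ z : Fin sA → ℂ, (Bosonic.heterodyneDensity DA ΩA ρ z : ℂ) •
        Bosonic.coherentProj DB ΩB (-(K.mulVec (star z))) := by
  have hone := hΩA.integral_heterodyneDensity hDA hρ
  have hp : MeasureTheory.Integrable (Bosonic.heterodyneDensity DA ΩA ρ) :=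
    -- A non-integrable function would have integral `0` by convention.
    .of_integral_ne_zero (by rw [hone]; exact one_ne_zero)
  have hint := hΩB.integrable_smul_coherentProj hDB K hp
  refine ⟨Bosonic.heterodyneDensity_nonneg hρ.1, hp, hone, hint, ?_⟩
  refine hΩB.ext_inner_clm hDB fun a b => ?_
  have hpi : (Real.pi ^ sB : ℂ) ≠ 0 :=
    pow_ne_zero sB (Complex.ofReal_ne_zero.mpr Real.pi_ne_zero)
  refine mul_left_cancel₀ hpi ?_
  -- The left matrix element becomes an integral of the characteristic function of `Φ ρ`. After the
  -- exchange of integrals, inversion is applied to each projection `|-K conj u⟩⟨-K conj u|`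
  -- separately.
  rw [← hΩB.integral_overlap_mul_trace hDB (hΦ.isChannel.isState hρ).isPositiveFiniteTrace,
    ContinuousLinearMap.integral_apply hint, ← integral_inner (hint.apply_continuousLinearMap _),
    ← MeasureTheory.integral_const_mul]
  simp only [hΦ.trace_map_mul hDA hΩA hDB hΩB hρ, ← MeasureTheory.integral_const_mul, ← mul_assoc]
  rw [MeasureTheory.integral_integral_swap
    (hΩB.integrable_overlap_mul_density hDB K hp a b)]
  refine MeasureTheory.integral_congr_ae (.of_forall fun u => ?_)
  simp only [mul_right_comm _ (Bosonic.heterodyneDensity DA ΩA ρ u : ℂ),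
    MeasureTheory.integral_mul_const, hΩB.integral_overlap_mul_inner hDB, smul_apply,
    Bosonic.coherentProj, InnerProductSpace.rankOne_apply, inner_smul_right]
  ring
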